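/- Let $\nu_1,\nu_2\ge 1$ be fixed integers and let $\lambda>1$ be a fixed real number. For each integer $M\ge 1$, coupons are drawn one at a time, independently and with replacement, from a pool consisting of two groups: $\nu_1M$ coupons of Group 1, each occurring at every draw with probability $p_1=p_1(M)>0$, and $\nu_2M$ coupons of Group 2, each occurring at every draw with probability $p_2=p_2(M)>0$, where $\nu_1Mp_1+\nu_2Mp_2=1$ and $p_2/p_1=\lambda$ for every $M$. For $j=1,2$ let $T_j=T_j(M)$ be the number of draws needed to collect every coupon of Group $j$ at least once, and let $T=T(M)=T_1\vee T_2=\max(T_1,T_2)$. Then $T$ is almost surely finite and square integrable for every $M$, and its variance satisfies $$V[T]\sim\frac{\pi^2(\nu_1+\lambda\nu_2)^2}{6}\,M^2\qquad\text{as } M\to\infty .$$ -/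

import Mathlib

open MeasureTheory ProbabilityTheory Filter Asymptotics

namespace CouponCollector

/-- `C 0, C 1, …` are the coupons drawn, independently and with replacement, from a pool that
consists of `M₁` coupons of Group 1 (the values `Sum.inl i`), each of which occurs with probability
`p₁ > 0`, and `M₂` coupons of Group 2 (the values `Sum.inr i`), each of which occurs with
probability `p₂ > 0`. The coupon drawn at the `n`-th trial, `n ≥ 1`, is `C (n - 1)`. -/
structure IsCouponSampling {Ω : Type*} [MeasurableSpace Ω] (μ : Measure Ω) (M₁ M₂ : ℕ)
    (p₁ p₂ : ℝ) (C : ℕ → Ω → Fin M₁ ⊕ Fin M₂) : Prop where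
  pos₁ : 0 < p₁
  pos₂ : 0 < p₂
  sum_eq_one : (M₁ : ℝ) * p₁ + (M₂ : ℝ) * p₂ = 1
  measurable : ∀ n, Measurable (C n)
  indep : iIndepFun C μ
  prob₁ : ∀ (n : ℕ) (i : Fin M₁), μ {ω | C n ω = Sum.inl i} = ENNReal.ofReal p₁
  prob₂ : ∀ (n : ℕ) (i : Fin M₂), μ {ω | C n ω = Sum.inr i} = ENNReal.ofReal p₂

/-- The number of trials needed to detect every coupon of the set `A` at least once: the least `k`
such that each coupon of `A` is among the first `k` coupons drawn (`⊤` if there is no such `k`). -/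
noncomputable def detectionTime {Ω ι : Type*} (C : ℕ → Ω → ι) (A : Set ι) (ω : Ω) : ℕ∞ :=
  ⨅ (k : ℕ) (_ : ∀ a ∈ A, ∃ n < k, C n ω = a), (k : ℕ∞)

/-- `T₁`, the number of trials needed to detect all coupons of Group 1. -/
noncomputable def T₁ {Ω : Type*} {M₁ M₂ : ℕ} (C : ℕ → Ω → Fin M₁ ⊕ Fin M₂) (ω : Ω) : ℕ∞ :=
  detectionTime C (Set.range Sum.inl) ω

/-- `T₂`, the number of trials needed to detect all coupons of Group 2. -/
noncomputable def T₂ {Ω : Type*} {M₁ M₂ : ℕ} (C : ℕ → Ω → Fin M₁ ⊕ Fin M₂) (ω : Ω) : ℕ∞ :=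
  detectionTime C (Set.range Sum.inr) ω

/-- `T = T₁ ∨ T₂`. -/
noncomputable def T {Ω : Type*} {M₁ M₂ : ℕ} (C : ℕ → Ω → Fin M₁ ⊕ Fin M₂) (ω : Ω) : ℕ∞ :=
  T₁ C ω ⊔ T₂ C ω

/-- `T` as a real random variable (with the value `0` where `T = ⊤`). -/
noncomputable def TReal {Ω : Type*} {M₁ M₂ : ℕ} (C : ℕ → Ω → Fin M₁ ⊕ Fin M₂) (ω : Ω) : ℝ :=
  ((T C ω).toNat : ℝ)

end CouponCollector

/-!
The time is Poissonized at the level of moments: inclusion-exclusion over the set `J` of missed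
coupons writes `P(T > n)` as an alternating sum of `(1 - p_J)ⁿ`, where `p_J` is the probability of
drawing from `J`. Since `∑ (1 - p_J)ⁿ = 1 / p_J = ∫ exp (-p_J t) dt` and
`∑ (n + 1) (1 - p_J)ⁿ = 1 / p_J² = ∫ t exp (-p_J t) dt`, the moments `E T` and `E T(T+1)` equal
`E X` and `E X²`, where `X` is the maximum of independent exponential variables whose rates are
the coupon probabilities (`IsCouponSampling.integral_TReal`,
`IsCouponSampling.integral_TReal_sq_add`). Only the tail of `X` occurs below, as an explicit
function of `t`.

In units of `1 / p₁ = (ν₁ + lam ν₂) M`, `X` is the maximum of `N = ν₁ M` exponentials of rate `1`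
and `K = ν₂ M` exponentials of rate `lam > 1`. The first group alone has a maximum with mean `H_N`
and variance exactly `∑_{k ≤ N} 1/k²`, which tends to `π²/6`
(`integral_expMaxTail`, `two_mul_integral_mul_expMaxTail`).
The second group changes the tail at `s` by `(1 - e⁻ˢ)ᴺ (1 - (1 - e^(-lam s))ᴷ)`. The first factor
is at most `exp (-N e⁻ˢ) ≤ aᵃ (N e⁻ˢ)⁻ᵃ` and the second is at most `K e^(-lam s)`; with
`1 < a < lam` the changes of the first two moments are `O(M^(1 - a))` (`exists_excess_le`), and so
vanish even after multiplication by `H_N = O(log M)`. The difference `E T` between `E T(T+1)` and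
`E T²` is `O(M log M)`, negligible against `M²`.
-/

namespace CouponCollector

open Set Real Topology

/-! ### Integrals of exponentials and of the maximum of exponential variables -/

lemma integral_exp_neg_mul {b : ℝ} (hb : 0 < b) : ∫ s in Ioi (0 : ℝ), exp (-(b * s)) = 1 / b := by
  simpa using Real.integral_rpow_mul_exp_neg_mul_Ioi one_pos hb

lemma integrableOn_exp_neg_mul {b : ℝ} (hb : 0 < b) :
    IntegrableOn (fun s : ℝ => exp (-(b * s))) (Ioi 0) :=
  Integrable.of_integral_ne_zero (by rw [integral_exp_neg_mul hb]; positivity)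

lemma integral_mul_exp_neg_mul {b : ℝ} (hb : 0 < b) :
    ∫ s in Ioi (0 : ℝ), s * exp (-(b * s)) = 1 / b ^ 2 := by
  have := Real.integral_rpow_mul_exp_neg_mul_Ioi two_pos hb
  norm_num at this
  rw [this, one_div]

lemma integrableOn_mul_exp_neg_mul {b : ℝ} (hb : 0 < b) :
    IntegrableOn (fun s : ℝ => s * exp (-(b * s))) (Ioi 0) :=
  Integrable.of_integral_ne_zero (by rw [integral_mul_exp_neg_mul hb]; positivity)

lemma one_sub_exp_neg_mem {s : ℝ} (hs : 0 < s) : 0 ≤ 1 - exp (-s) ∧ 1 - exp (-s) ≤ 1 := by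
  have h1 : exp (-s) ≤ 1 := exp_le_one_iff.2 (by linarith)
  have h2 := exp_pos (-s)
  constructor <;> linarith

/-- Bernoulli's inequality: the tail of the maximum is at most the sum of the tails. -/
lemma one_sub_one_sub_pow_le {x : ℝ} (hx : x ≤ 1) (N : ℕ) : 1 - (1 - x) ^ N ≤ N * x := by
  have := one_add_mul_le_pow (a := -x) (by linarith) N
  rw [← sub_eq_add_neg] at this
  linarith

/-- The tail `P(Y > s)` of the maximum `Y` of `N` independent standard exponential variables. -/
noncomputable def expMaxTail (N : ℕ) (s : ℝ) : ℝ := 1 - (1 - exp (-s)) ^ N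

lemma expMaxTail_nonneg (N : ℕ) {s : ℝ} (hs : 0 < s) : 0 ≤ expMaxTail N s :=
  sub_nonneg.2 (pow_le_one₀ (one_sub_exp_neg_mem hs).1 (one_sub_exp_neg_mem hs).2)

lemma expMaxTail_le (N : ℕ) {s : ℝ} (hs : 0 < s) : expMaxTail N s ≤ N * exp (-s) :=
  one_sub_one_sub_pow_le (exp_le_one_iff.2 (by linarith)) N

lemma integrableOn_expMaxTail (N : ℕ) : IntegrableOn (expMaxTail N) (Ioi 0) := by
  have h := (integrableOn_exp_neg_mul one_pos).const_mul (N : ℝ)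
  refine Integrable.mono' h (by unfold expMaxTail; fun_prop) ?_
  filter_upwards [ae_restrict_mem measurableSet_Ioi] with s hs
  rw [norm_of_nonneg (expMaxTail_nonneg N hs)]
  simpa using expMaxTail_le N hs

lemma integrableOn_mul_expMaxTail (N : ℕ) :
    IntegrableOn (fun s => s * expMaxTail N s) (Ioi 0) := by
  have h := (integrableOn_mul_exp_neg_mul one_pos).const_mul (N : ℝ)
  refine Integrable.mono' h (by unfold expMaxTail; fun_prop) ?_
  filter_upwards [ae_restrict_mem measurableSet_Ioi] with s hs
  have hs' : (0 : ℝ) < s := hs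
  rw [norm_of_nonneg (mul_nonneg hs'.le (expMaxTail_nonneg N hs))]
  have := mul_le_mul_of_nonneg_left (expMaxTail_le N hs) hs'.le
  simp only [one_mul]
  linarith

lemma expMaxTail_succ (N : ℕ) (s : ℝ) :
    expMaxTail (N + 1) s = expMaxTail N s + exp (-s) * (1 - exp (-s)) ^ N := by
  unfold expMaxTail; ring

lemma hasDerivAt_expMaxTail (N : ℕ) (s : ℝ) :
    HasDerivAt (expMaxTail (N + 1)) (-((N + 1) * (exp (-s) * (1 - exp (-s)) ^ N))) s := by
  have h := ((((hasDerivAt_neg s).exp).const_sub 1).pow (N + 1)).const_sub 1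
  refine h.congr_deriv ?_
  push_cast
  simp
  ring

lemma tendsto_mul_expMaxTail (N : ℕ) :
    Tendsto (fun s => s * expMaxTail N s) atTop (𝓝 0) := by
  have h : Tendsto (fun s : ℝ => (N : ℝ) * (s ^ 1 * exp (-s))) atTop (𝓝 0) := by
    simpa using (tendsto_pow_mul_exp_neg_atTop_nhds_zero 1).const_mul (N : ℝ)
  refine squeeze_zero' ?_ ?_ h
  · filter_upwards [eventually_gt_atTop 0] with s hs
    exact mul_nonneg hs.le (expMaxTail_nonneg N hs)
  · filter_upwards [eventually_gt_atTop 0] with s hs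
    have := mul_le_mul_of_nonneg_left (expMaxTail_le N hs) hs.le
    simp only [pow_one]
    linarith

lemma tendsto_expMaxTail (N : ℕ) : Tendsto (expMaxTail N) atTop (𝓝 0) := by
  have h : Tendsto (fun s : ℝ => 1 - (1 - exp (-s)) ^ N) atTop (𝓝 (1 - (1 - 0) ^ N)) :=
    ((tendsto_exp_neg_atTop_nhds_zero.const_sub 1).pow N).const_sub 1
  rw [sub_zero, one_pow, sub_self] at h
  exact h

lemma integrableOn_exp_mul_pow (N : ℕ) :
    IntegrableOn (fun s => exp (-s) * (1 - exp (-s)) ^ N) (Ioi 0) := by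
  refine ((integrableOn_expMaxTail (N + 1)).sub (integrableOn_expMaxTail N)).congr ?_
  refine Eventually.of_forall fun s => ?_
  simp [expMaxTail_succ]

lemma integrableOn_mul_exp_mul_pow (N : ℕ) :
    IntegrableOn (fun s => s * (exp (-s) * (1 - exp (-s)) ^ N)) (Ioi 0) := by
  refine ((integrableOn_mul_expMaxTail (N + 1)).sub (integrableOn_mul_expMaxTail N)).congr ?_
  refine Eventually.of_forall fun s => ?_
  simp [expMaxTail_succ, mul_add]

lemma integral_exp_mul_pow (N : ℕ) :
    ∫ s in Ioi (0 : ℝ), exp (-s) * (1 - exp (-s)) ^ N = 1 / (N + 1) := by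
  have h := integral_Ioi_of_hasDerivAt_of_tendsto' (a := 0)
    (fun s _ => hasDerivAt_expMaxTail N s) (by
      exact ((integrableOn_exp_mul_pow N).const_mul _).neg) (tendsto_expMaxTail (N + 1))
  rw [integral_neg, integral_const_mul] at h
  simp [expMaxTail] at h
  field_simp
  linarith

/-- The harmonic sum `1 + 1/2 + ⋯ + 1/N`. -/
noncomputable def harm (N : ℕ) : ℝ := ∑ i ∈ Finset.range N, 1 / ((i : ℝ) + 1)

/-- `E Y` for the maximum `Y` of `N` independent standard exponential variables. -/
lemma integral_expMaxTail (N : ℕ) : ∫ s in Ioi (0 : ℝ), expMaxTail N s = harm N := by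
  induction N with
  | zero => simp [expMaxTail, harm]
  | succ N ih =>
    simp_rw [expMaxTail_succ]
    rw [integral_add (integrableOn_expMaxTail N) (integrableOn_exp_mul_pow N), ih,
      integral_exp_mul_pow, harm, harm, Finset.sum_range_succ]

/-- Integration by parts against `integral_expMaxTail`. -/
lemma integral_mul_exp_mul_pow (N : ℕ) :
    ∫ s in Ioi (0 : ℝ), s * (exp (-s) * (1 - exp (-s)) ^ N) = harm (N + 1) / (N + 1) := by
  have hi := (integrableOn_expMaxTail (N + 1)).sub
    ((integrableOn_mul_exp_mul_pow N).const_mul ((N : ℝ) + 1))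
  have h := integral_Ioi_of_hasDerivAt_of_tendsto' (a := 0)
    (fun s _ => ((hasDerivAt_id s).mul (hasDerivAt_expMaxTail N s)).congr_deriv
      (show _ = expMaxTail (N + 1) s - ((N : ℝ) + 1) * (s * (exp (-s) * (1 - exp (-s)) ^ N)) by
        simp; ring)) hi (tendsto_mul_expMaxTail (N + 1))
  rw [integral_sub (integrableOn_expMaxTail (N + 1))
    ((integrableOn_mul_exp_mul_pow N).const_mul _), integral_const_mul, integral_expMaxTail] at h
  simp at h
  rw [eq_div_iff (by positivity)]
  linarith

/-- `E Y²` for the maximum `Y` of `N` independent standard exponential variables; together with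
`integral_expMaxTail` it says that the variance of `Y` is `∑ 1/k²`. -/
lemma two_mul_integral_mul_expMaxTail (N : ℕ) :
    2 * ∫ s in Ioi (0 : ℝ), s * expMaxTail N s =
      harm N ^ 2 + ∑ i ∈ Finset.range N, 1 / ((i : ℝ) + 1) ^ 2 := by
  induction N with
  | zero => simp [expMaxTail, harm]
  | succ N ih =>
    simp_rw [expMaxTail_succ, mul_add]
    rw [integral_add (integrableOn_mul_expMaxTail N) (integrableOn_mul_exp_mul_pow N), mul_add, ih,
      integral_mul_exp_mul_pow, Finset.sum_range_succ]
    have : harm (N + 1) = harm N + 1 / ((N : ℝ) + 1) := by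
      rw [harm, harm, Finset.sum_range_succ]
    rw [this]
    field_simp
    ring

lemma harm_nonneg (N : ℕ) : 0 ≤ harm N := Finset.sum_nonneg fun i _ => by positivity

lemma harm_le_one_add_log (N : ℕ) : harm N ≤ 1 + log N := by
  have h := harmonic_le_one_add_log N
  rw [harmonic] at h
  push_cast at h
  simpa [harm] using h

/-! ### The contribution of the faster group -/

/-- The increase of the tail at `s` when `K` independent exponential variables of rate `lam` join
the `N` of rate `1`. -/
noncomputable def tailExcess (N K : ℕ) (lam s : ℝ) : ℝ :=
  (1 - exp (-s)) ^ N * (1 - (1 - exp (-(lam * s))) ^ K)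

lemma tailExcess_nonneg (N K : ℕ) {lam s : ℝ} (hl : 0 < lam) (hs : 0 < s) :
    0 ≤ tailExcess N K lam s :=
  mul_nonneg (pow_nonneg (one_sub_exp_neg_mem hs).1 N) (expMaxTail_nonneg K (mul_pos hl hs))

/-- `(y / a)ᵃ ≤ (e^(y/a))ᵃ`, rearranged. -/
lemma exp_neg_le_rpow {a y : ℝ} (ha : 0 < a) (hy : 0 < y) : exp (-y) ≤ a ^ a * y ^ (-a) := by
  have h1 : y / a ≤ exp (y / a) := by linarith [add_one_le_exp (y / a)]
  have h2 : (y / a) ^ a ≤ exp (y / a) ^ a := rpow_le_rpow (by positivity) h1 ha.le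
  rw [← exp_mul, div_mul_cancel₀ _ ha.ne', div_rpow hy.le ha.le] at h2
  have hya : 0 < y ^ a := rpow_pos_of_pos hy a
  have haa : 0 < a ^ a := rpow_pos_of_pos ha a
  rw [rpow_neg hy.le, exp_neg, ← div_eq_mul_inv]
  rw [div_le_iff₀ haa] at h2
  rw [inv_le_comm₀ (exp_pos y) (by positivity), inv_div, div_le_iff₀ haa]
  exact h2

/-- The group of `N` exponentials of rate `1` is complete at time `s` with probability at most
`exp (-N e⁻ˢ)`, which beats any power of `N e⁻ˢ`; the exponent `a < lam` is what leaves an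
exponential decay in `s`. -/
lemma tailExcess_le (N K : ℕ) {lam a s : ℝ} (hN : 0 < N) (ha : 0 < a) (hl : 0 < lam)
    (hs : 0 < s) :
    tailExcess N K lam s ≤ a ^ a * (N : ℝ) ^ (-a) * K * exp (-((lam - a) * s)) := by
  have hN' : (0 : ℝ) < N := by exact_mod_cast hN
  have h1 : (1 - exp (-s)) ^ N ≤ a ^ a * ((N : ℝ) ^ (-a) * exp (a * s)) := by
    calc (1 - exp (-s)) ^ N ≤ exp (-exp (-s)) ^ N := by
          gcongr
          · exact (one_sub_exp_neg_mem hs).1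
          · exact one_sub_le_exp_neg _
      _ = exp (-(N * exp (-s))) := by rw [← exp_nat_mul]; ring_nf
      _ ≤ a ^ a * (N * exp (-s)) ^ (-a) := exp_neg_le_rpow ha (by positivity)
      _ = _ := by
          rw [mul_rpow hN'.le (exp_pos _).le, ← exp_mul]
          ring_nf
  have h2 : 1 - (1 - exp (-(lam * s))) ^ K ≤ K * exp (-(lam * s)) :=
    expMaxTail_le K (mul_pos hl hs)
  calc tailExcess N K lam s
      ≤ a ^ a * ((N : ℝ) ^ (-a) * exp (a * s)) * (K * exp (-(lam * s))) :=
        mul_le_mul h1 h2 (expMaxTail_nonneg K (mul_pos hl hs)) (by positivity)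
    _ = a ^ a * (N : ℝ) ^ (-a) * K * (exp (a * s) * exp (-(lam * s))) := by ring
    _ = _ := by rw [← exp_add]; ring_nf

lemma integrableOn_tailExcess (N K : ℕ) {lam a : ℝ} (hN : 0 < N) (ha : 0 < a) (hl : a < lam) :
    IntegrableOn (tailExcess N K lam) (Ioi 0) := by
  refine Integrable.mono' ((integrableOn_exp_neg_mul (sub_pos.2 hl)).const_mul
    (a ^ a * (N : ℝ) ^ (-a) * K)) (by unfold tailExcess; fun_prop) ?_
  filter_upwards [ae_restrict_mem measurableSet_Ioi] with s hs
  rw [norm_of_nonneg (tailExcess_nonneg N K (ha.trans hl) hs)]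
  exact tailExcess_le N K hN ha (ha.trans hl) hs

lemma mul_tailExcess_le (N K : ℕ) {lam a s : ℝ} (hN : 0 < N) (ha : 0 < a) (hl : 0 < lam)
    (hs : 0 < s) :
    s * tailExcess N K lam s ≤ a ^ a * (N : ℝ) ^ (-a) * K * (s * exp (-((lam - a) * s))) := by
  have := mul_le_mul_of_nonneg_left (tailExcess_le N K hN ha hl hs) hs.le
  linarith

lemma integrableOn_mul_tailExcess (N K : ℕ) {lam a : ℝ} (hN : 0 < N) (ha : 0 < a) (hl : a < lam) :
    IntegrableOn (fun s => s * tailExcess N K lam s) (Ioi 0) := by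
  refine Integrable.mono' ((integrableOn_mul_exp_neg_mul (sub_pos.2 hl)).const_mul
    (a ^ a * (N : ℝ) ^ (-a) * K)) (by unfold tailExcess; fun_prop) ?_
  filter_upwards [ae_restrict_mem measurableSet_Ioi] with s hs
  rw [norm_of_nonneg (mul_nonneg (le_of_lt hs) (tailExcess_nonneg N K (ha.trans hl) hs))]
  exact mul_tailExcess_le N K hN ha (ha.trans hl) hs

lemma integral_tailExcess_le (N K : ℕ) {lam a : ℝ} (hN : 0 < N) (ha : 0 < a) (hl : a < lam) :
    ∫ s in Ioi (0 : ℝ), tailExcess N K lam s ≤ a ^ a * (N : ℝ) ^ (-a) * K * (1 / (lam - a)) := by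
  rw [← integral_exp_neg_mul (sub_pos.2 hl), ← integral_const_mul]
  exact setIntegral_mono_on (integrableOn_tailExcess N K hN ha hl)
    ((integrableOn_exp_neg_mul (sub_pos.2 hl)).const_mul _) measurableSet_Ioi
    fun s hs => tailExcess_le N K hN ha (ha.trans hl) hs

lemma integral_mul_tailExcess_le (N K : ℕ) {lam a : ℝ} (hN : 0 < N) (ha : 0 < a) (hl : a < lam) :
    ∫ s in Ioi (0 : ℝ), s * tailExcess N K lam s ≤
      a ^ a * (N : ℝ) ^ (-a) * K * (1 / (lam - a) ^ 2) := by
  rw [← integral_mul_exp_neg_mul (sub_pos.2 hl), ← integral_const_mul]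
  exact setIntegral_mono_on (integrableOn_mul_tailExcess N K hN ha hl)
    ((integrableOn_mul_exp_neg_mul (sub_pos.2 hl)).const_mul _) measurableSet_Ioi
    fun s hs => mul_tailExcess_le N K hN ha (ha.trans hl) hs

/-! ### Summation by tails -/

/-- A function `∑_{n < X} w n` of a random natural number `X` has expectation `∑ w n P(n < X)`. -/
lemma integral_sum_range_of_hasSum {Ω : Type*} [MeasurableSpace Ω] {μ : Measure Ω}
    [IsProbabilityMeasure μ] {X : Ω → ℕ} (hX : Measurable X) {w : ℕ → ℝ} (hw : ∀ n, 0 ≤ w n)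
    {S : ℝ} (hS : HasSum (fun n => w n * μ.real {ω | n < X ω}) S) :
    Integrable (fun ω => ∑ n ∈ Finset.range (X ω), w n) μ ∧
      ∫ ω, ∑ n ∈ Finset.range (X ω), w n ∂μ = S := by
  have hmeas : Measurable (fun ω => ∑ n ∈ Finset.range (X ω), w n) :=
    (measurable_from_nat (f := fun k => ∑ n ∈ Finset.range k, w n)).comp hX
  have hnn : ∀ ω, 0 ≤ ∑ n ∈ Finset.range (X ω), w n := fun ω =>
    Finset.sum_nonneg fun n _ => hw n
  have hset : ∀ n, MeasurableSet {ω | n < X ω} := fun n => measurableSet_lt measurable_const hX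
  have hl : ∫⁻ ω, ENNReal.ofReal (∑ n ∈ Finset.range (X ω), w n) ∂μ = ENNReal.ofReal S := by
    have h1 : ∀ ω, ENNReal.ofReal (∑ n ∈ Finset.range (X ω), w n) =
        ∑' n, {ω | n < X ω}.indicator (fun _ => ENNReal.ofReal (w n)) ω := by
      intro ω
      rw [tsum_eq_sum (s := Finset.range (X ω)), ENNReal.ofReal_sum_of_nonneg fun n _ => hw n]
      · refine Finset.sum_congr rfl fun n hn => ?_
        rw [indicator_of_mem (by simpa using hn)]
      · intro n hn
        exact indicator_of_notMem (by simpa using hn) _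
    simp_rw [h1]
    rw [lintegral_tsum fun n => (measurable_const.indicator (hset n)).aemeasurable, ← hS.tsum_eq,
      ENNReal.ofReal_tsum_of_nonneg (fun n => mul_nonneg (hw n) measureReal_nonneg) hS.summable]
    refine tsum_congr fun n => ?_
    rw [lintegral_indicator_const (hset n), ENNReal.ofReal_mul (hw n), ofReal_measureReal]
  have hS0 : 0 ≤ S := hS.nonneg fun n => mul_nonneg (hw n) measureReal_nonneg
  refine ⟨⟨hmeas.aestronglyMeasurable, ?_⟩, ?_⟩
  · rw [hasFiniteIntegral_iff_ofReal (Eventually.of_forall hnn), hl]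
    exact ENNReal.ofReal_lt_top
  · rw [integral_eq_lintegral_of_nonneg_ae (Eventually.of_forall hnn) hmeas.aestronglyMeasurable,
      hl, ENNReal.toReal_ofReal hS0]

lemma hasSum_succ_mul_geometric {r : ℝ} (h0 : 0 ≤ r) (h1 : r < 1) :
    HasSum (fun n : ℕ => ((n : ℝ) + 1) * r ^ n) (1 / (1 - r) ^ 2) := by
  have := hasSum_choose_mul_geometric_of_norm_lt_one (𝕜 := ℝ) (r := r) 1
    (by rwa [norm_of_nonneg h0])
  simpa using this

/-! ### The tail of the maximum of exponential variables with different rates -/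

section Poisson

variable {ι : Type*} [Fintype ι]

/-- The tail `P(X > t)` of the maximum `X` of independent exponential variables of rates `p a`,
that is, of the completion time when the coupons are drawn at the times of a Poisson process. -/
noncomputable def poissonTail (p : ι → ℝ) (t : ℝ) : ℝ := 1 - ∏ a, (1 - exp (-(p a * t)))

lemma poissonTail_eq (p : ι → ℝ) (t : ℝ) :
    poissonTail p t = ∑ J : Finset ι with J.Nonempty,
      (-1 : ℝ) ^ (J.card + 1) * exp (-((∑ a ∈ J, p a) * t)) := by
  classical
  have h : ∏ a, (1 - exp (-(p a * t))) =
      ∑ J : Finset ι, (-1 : ℝ) ^ J.card * exp (-((∑ a ∈ J, p a) * t)) := by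
    rw [Finset.prod_sub, Finset.powerset_univ]
    refine Finset.sum_congr rfl fun J _ => ?_
    rw [Finset.prod_const_one, mul_one, ← exp_sum, Finset.sum_mul, Finset.sum_neg_distrib]
  rw [poissonTail, h, ← Finset.sum_filter_add_sum_filter_not _ (fun J : Finset ι => J.Nonempty)]
  have h2 : ({J : Finset ι | ¬ J.Nonempty} : Finset (Finset ι)) = {∅} := by
    ext J; simp
  rw [h2]
  simp [pow_succ]

lemma sum_pos_le_one {p : ι → ℝ} (hp : ∀ a, 0 < p a) (hsum : ∑ a, p a = 1) {J : Finset ι}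
    (hJ : J.Nonempty) : 0 < ∑ a ∈ J, p a ∧ ∑ a ∈ J, p a ≤ 1 :=
  ⟨Finset.sum_pos (fun a _ => hp a) hJ, hsum ▸
    Finset.sum_le_sum_of_subset_of_nonneg (Finset.subset_univ J) fun a _ _ => (hp a).le⟩

end Poisson

/-! ### The probability that the collection is incomplete -/

section Sampling

variable {Ω ι : Type*}

/-- The event that coupon `a` is not among the first `n` coupons drawn. -/
def missed (C : ℕ → Ω → ι) (n : ℕ) (a : ι) : Set Ω := {ω | ∀ m < n, C m ω ≠ a}

/-- The event that some coupon is not among the first `n` coupons drawn. -/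
def incomplete (C : ℕ → Ω → ι) (n : ℕ) : Set Ω := {ω | ∃ a, ω ∈ missed C n a}

variable [MeasurableSpace Ω] {μ : Measure Ω} [MeasurableSpace ι] [MeasurableSingletonClass ι]
  {C : ℕ → Ω → ι} {p : ι → ℝ}

lemma measurableSet_missed (hC : ∀ n, Measurable (C n)) (n : ℕ) (a : ι) :
    MeasurableSet (missed C n a) := by
  have : missed C n a = ⋂ m ∈ Finset.range n, C m ⁻¹' {a}ᶜ := by
    ext ω; simp [missed]
  rw [this]
  exact Finset.measurableSet_biInter _ fun m _ => hC m (measurableSet_singleton a).compl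

lemma measurableSet_incomplete [Countable ι] (hC : ∀ n, Measurable (C n)) (n : ℕ) :
    MeasurableSet (incomplete C n) := by
  have : incomplete C n = ⋃ a, missed C n a := by ext; simp [incomplete]
  rw [this]
  exact MeasurableSet.iUnion fun a => measurableSet_missed hC n a

variable [IsProbabilityMeasure μ]

lemma measureReal_biInter_missed (hC : ∀ n, Measurable (C n)) (hind : iIndepFun C μ)
    (hp : ∀ a, 0 ≤ p a) (hprob : ∀ n a, μ {ω | C n ω = a} = ENNReal.ofReal (p a))
    (n : ℕ) (J : Finset ι) :
    μ.real (⋂ a ∈ J, missed C n a) = (1 - ∑ a ∈ J, p a) ^ n := by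
  have h1 : ⋂ a ∈ J, missed C n a = ⋂ m ∈ Finset.range n, C m ⁻¹' (J : Set ι)ᶜ := by
    ext ω
    simp only [missed, mem_iInter, mem_ofPred_eq, Finset.mem_range, mem_preimage, mem_compl_iff,
      Finset.mem_coe]
    exact ⟨fun h m hm hJ => h _ hJ m hm rfl, fun h a ha m hm he => h m hm (he ▸ ha)⟩
  have h2 : ∀ m, μ.real (C m ⁻¹' (J : Set ι)ᶜ) = 1 - ∑ a ∈ J, p a := by
    intro m
    rw [preimage_compl, probReal_compl_eq_one_sub (hC m J.measurableSet)]
    congr 1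
    rw [← sum_measureReal_preimage_singleton J fun a _ => hC m (measurableSet_singleton a)]
    refine Finset.sum_congr rfl fun a _ => ?_
    have : C m ⁻¹' {a} = {ω | C m ω = a} := rfl
    rw [this, measureReal_def, hprob, ENNReal.toReal_ofReal (hp a)]
  rw [h1, measureReal_def, hind.meas_biInter fun m _ => ⟨_, J.measurableSet.compl, rfl⟩,
    ENNReal.toReal_prod]
  simp_rw [← measureReal_def, h2]
  simp

variable [Fintype ι]

/-- Inclusion-exclusion over the set `J` of coupons missed. -/
lemma measureReal_incomplete (hC : ∀ n, Measurable (C n)) (hind : iIndepFun C μ)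
    (hp : ∀ a, 0 ≤ p a) (hprob : ∀ n a, μ {ω | C n ω = a} = ENNReal.ofReal (p a)) (n : ℕ) :
    μ.real (incomplete C n) = ∑ J : Finset ι with J.Nonempty,
      (-1 : ℝ) ^ (J.card + 1) * (1 - ∑ a ∈ J, p a) ^ n := by
  have h1 : incomplete C n = ⋃ a ∈ Finset.univ, missed C n a := by ext; simp [incomplete]
  rw [h1, measureReal_biUnion_eq_sum_powerset (fun a _ => measurableSet_missed hC n a)]
  rw [Finset.powerset_univ]
  refine Finset.sum_congr rfl fun J _ => ?_
  rw [measureReal_biInter_missed hC hind hp hprob]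

/-- Poissonization of the first moment. -/
lemma hasSum_measureReal_incomplete (hC : ∀ n, Measurable (C n)) (hind : iIndepFun C μ)
    (hp : ∀ a, 0 < p a) (hsum : ∑ a, p a = 1)
    (hprob : ∀ n a, μ {ω | C n ω = a} = ENNReal.ofReal (p a)) :
    HasSum (fun n => μ.real (incomplete C n)) (∫ t in Ioi (0 : ℝ), poissonTail p t) := by
  have h : ∫ t in Ioi (0 : ℝ), poissonTail p t = ∑ J : Finset ι with J.Nonempty,
      (-1 : ℝ) ^ (J.card + 1) * (1 / ∑ a ∈ J, p a) := by
    simp_rw [poissonTail_eq]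
    rw [integral_finsetSum]
    · refine Finset.sum_congr rfl fun J hJ => ?_
      rw [integral_const_mul, integral_exp_neg_mul (sum_pos_le_one hp hsum (by simpa using hJ)).1]
    · intro J hJ
      exact (integrableOn_exp_neg_mul (sum_pos_le_one hp hsum (by simpa using hJ)).1).const_mul _
  rw [h]
  simp_rw [measureReal_incomplete hC hind (fun a => (hp a).le) hprob]
  refine hasSum_sum fun J hJ => HasSum.mul_left _ ?_
  obtain ⟨h0, h1⟩ := sum_pos_le_one hp hsum (by simpa using hJ : J.Nonempty)
  have := hasSum_geometric_of_lt_one (r := 1 - ∑ a ∈ J, p a) (by linarith) (by linarith)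
  simpa using this

/-- Poissonization of the second moment. -/
lemma hasSum_succ_mul_measureReal_incomplete (hC : ∀ n, Measurable (C n)) (hind : iIndepFun C μ)
    (hp : ∀ a, 0 < p a) (hsum : ∑ a, p a = 1)
    (hprob : ∀ n a, μ {ω | C n ω = a} = ENNReal.ofReal (p a)) :
    HasSum (fun n : ℕ => ((n : ℝ) + 1) * μ.real (incomplete C n))
      (∫ t in Ioi (0 : ℝ), t * poissonTail p t) := by
  have h : ∫ t in Ioi (0 : ℝ), t * poissonTail p t = ∑ J : Finset ι with J.Nonempty,
      (-1 : ℝ) ^ (J.card + 1) * (1 / (∑ a ∈ J, p a) ^ 2) := by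
    have ht : ∀ t, t * poissonTail p t = ∑ J : Finset ι with J.Nonempty,
        (-1 : ℝ) ^ (J.card + 1) * (t * exp (-((∑ a ∈ J, p a) * t))) := fun t => by
      rw [poissonTail_eq, Finset.mul_sum]
      exact Finset.sum_congr rfl fun J _ => mul_left_comm _ _ _
    simp_rw [ht]
    rw [integral_finsetSum]
    · refine Finset.sum_congr rfl fun J hJ => ?_
      rw [integral_const_mul,
        integral_mul_exp_neg_mul (sum_pos_le_one hp hsum (by simpa using hJ)).1]
    · intro J hJ
      exact (integrableOn_mul_exp_neg_mul
        (sum_pos_le_one hp hsum (by simpa using hJ)).1).const_mul _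
  have hn : ∀ n : ℕ, ((n : ℝ) + 1) * μ.real (incomplete C n) =
      ∑ J : Finset ι with J.Nonempty,
        (-1 : ℝ) ^ (J.card + 1) * (((n : ℝ) + 1) * (1 - ∑ a ∈ J, p a) ^ n) := fun n => by
    rw [measureReal_incomplete hC hind (fun a => (hp a).le) hprob, Finset.mul_sum]
    exact Finset.sum_congr rfl fun J _ => mul_left_comm _ _ _
  rw [h]
  simp_rw [hn]
  refine hasSum_sum fun J hJ => HasSum.mul_left _ ?_
  obtain ⟨h0, h1⟩ := sum_pos_le_one hp hsum (by simpa using hJ : J.Nonempty)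
  have := hasSum_succ_mul_geometric (r := 1 - ∑ a ∈ J, p a) (by linarith) (by linarith)
  simpa using this

end Sampling

/-! ### Moments of the collection time -/

lemma lt_detectionTime_iff {Ω ι : Type*} (C : ℕ → Ω → ι) (A : Set ι) (ω : Ω) (n : ℕ) :
    (n : ℕ∞) < detectionTime C A ω ↔ ∃ a ∈ A, ω ∈ missed C n a := by
  constructor
  · intro h
    by_contra! hc
    have : detectionTime C A ω ≤ n := by
      refine iInf₂_le n fun a ha => ?_
      have := hc a ha
      simp only [missed, mem_ofPred_eq] at this
      push Not at this
      exact this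
    exact absurd h this.not_gt
  · rintro ⟨a, ha, hm⟩
    have : ((n + 1 : ℕ) : ℕ∞) ≤ detectionTime C A ω := by
      refine le_iInf₂ fun k hk => ?_
      obtain ⟨m, hmk, he⟩ := hk a ha
      have : n ≤ m := by
        by_contra! hlt
        exact hm m hlt he
      exact_mod_cast (by omega : n + 1 ≤ k)
    exact lt_of_lt_of_le (by exact_mod_cast Nat.lt_succ_self n) this

instance instMeasurableSingletonClassSum {α β : Type*} [MeasurableSpace α] [MeasurableSpace β]
    [DiscreteMeasurableSpace α] [DiscreteMeasurableSpace β] : MeasurableSingletonClass (α ⊕ β) :=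
  ⟨fun _ => measurableSet_sum_iff.2 ⟨.of_discrete, .of_discrete⟩⟩

variable {Ω : Type*} {M₁ M₂ : ℕ}

lemma lt_T_iff (C : ℕ → Ω → Fin M₁ ⊕ Fin M₂) (ω : Ω) (n : ℕ) :
    (n : ℕ∞) < T C ω ↔ ω ∈ incomplete C n := by
  simp [T, T₁, T₂, lt_sup_iff, lt_detectionTime_iff, incomplete]

lemma T_eq_top_iff (C : ℕ → Ω → Fin M₁ ⊕ Fin M₂) (ω : Ω) :
    T C ω = ⊤ ↔ ∀ n, ω ∈ incomplete C n := by
  simp_rw [← lt_T_iff, ENat.eq_top_iff_forall_gt]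

lemma lt_toNat_T_iff (C : ℕ → Ω → Fin M₁ ⊕ Fin M₂) (ω : Ω) (n : ℕ) :
    n < (T C ω).toNat ↔ ω ∈ incomplete C n ∧ T C ω ≠ ⊤ := by
  rw [← lt_T_iff]
  induction T C ω using ENat.recTopCoe with
  | top => simp
  | coe k => simp

variable [MeasurableSpace Ω] {μ : Measure Ω} {p₁ p₂ : ℝ} {C : ℕ → Ω → Fin M₁ ⊕ Fin M₂}

lemma measurable_toNat_T (hC : ∀ n, Measurable (C n)) : Measurable fun ω => (T C ω).toNat := by
  refine measurable_of_Ioi fun n => ?_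
  have : (fun ω => (T C ω).toNat) ⁻¹' Ioi n = incomplete C n \ ⋂ k, incomplete C k := by
    ext ω
    simp only [mem_preimage, mem_Ioi, lt_toNat_T_iff, Ne, T_eq_top_iff, Set.mem_sdiff, mem_iInter]
  rw [this]
  exact (measurableSet_incomplete hC n).diff
    (MeasurableSet.iInter fun k => measurableSet_incomplete hC k)

/-- The probabilities of drawing the coupons of the two groups. -/
def couponProb (M₁ M₂ : ℕ) (p₁ p₂ : ℝ) : Fin M₁ ⊕ Fin M₂ → ℝ := Sum.elim (fun _ => p₁) fun _ => p₂

lemma IsCouponSampling.couponProb_pos (h : IsCouponSampling μ M₁ M₂ p₁ p₂ C)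
    (a : Fin M₁ ⊕ Fin M₂) : 0 < couponProb M₁ M₂ p₁ p₂ a := by
  cases a
  · exact h.pos₁
  · exact h.pos₂

lemma IsCouponSampling.sum_couponProb (h : IsCouponSampling μ M₁ M₂ p₁ p₂ C) :
    ∑ a, couponProb M₁ M₂ p₁ p₂ a = 1 := by
  simpa [couponProb] using h.sum_eq_one

lemma IsCouponSampling.measure_eq (h : IsCouponSampling μ M₁ M₂ p₁ p₂ C) (n : ℕ)
    (a : Fin M₁ ⊕ Fin M₂) :
    μ {ω | C n ω = a} = ENNReal.ofReal (couponProb M₁ M₂ p₁ p₂ a) := by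
  cases a
  · exact h.prob₁ n _
  · exact h.prob₂ n _

variable [IsProbabilityMeasure μ]

lemma IsCouponSampling.hasSum_incomplete (h : IsCouponSampling μ M₁ M₂ p₁ p₂ C) :
    HasSum (fun n => μ.real (incomplete C n))
      (∫ t in Ioi (0 : ℝ), poissonTail (couponProb M₁ M₂ p₁ p₂) t) :=
  hasSum_measureReal_incomplete h.measurable h.indep h.couponProb_pos h.sum_couponProb h.measure_eq

lemma IsCouponSampling.hasSum_succ_mul_incomplete (h : IsCouponSampling μ M₁ M₂ p₁ p₂ C) :
    HasSum (fun n : ℕ => ((n : ℝ) + 1) * μ.real (incomplete C n))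
      (∫ t in Ioi (0 : ℝ), t * poissonTail (couponProb M₁ M₂ p₁ p₂) t) :=
  hasSum_succ_mul_measureReal_incomplete h.measurable h.indep h.couponProb_pos h.sum_couponProb
    h.measure_eq

lemma IsCouponSampling.ae_T_ne_top (h : IsCouponSampling μ M₁ M₂ p₁ p₂ C) :
    ∀ᵐ ω ∂μ, T C ω ≠ ⊤ := by
  have h0 := h.hasSum_incomplete.summable.tendsto_atTop_zero
  have h1 : μ.real {ω | T C ω = ⊤} ≤ 0 := by
    refine ge_of_tendsto' h0 fun n => measureReal_mono fun ω hω => ?_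
    exact (T_eq_top_iff C ω).1 hω n
  rw [ae_iff]
  simp only [ne_eq, not_not]
  exact (measureReal_eq_zero_iff).1 (le_antisymm h1 measureReal_nonneg)

lemma IsCouponSampling.measureReal_lt_toNat_T (h : IsCouponSampling μ M₁ M₂ p₁ p₂ C) (n : ℕ) :
    μ.real {ω | n < (T C ω).toNat} = μ.real (incomplete C n) := by
  refine measureReal_congr ?_
  filter_upwards [h.ae_T_ne_top] with ω hω
  exact propext ((lt_toNat_T_iff C ω n).trans (and_iff_left hω))

lemma IsCouponSampling.integral_TReal (h : IsCouponSampling μ M₁ M₂ p₁ p₂ C) :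
    Integrable (TReal C) μ ∧
      ∫ ω, TReal C ω ∂μ = ∫ t in Ioi (0 : ℝ), poissonTail (couponProb M₁ M₂ p₁ p₂) t := by
  have hS := h.hasSum_incomplete
  simp_rw [← h.measureReal_lt_toNat_T] at hS
  have := integral_sum_range_of_hasSum (measurable_toNat_T h.measurable) (w := fun _ => 1)
    (fun _ => zero_le_one) (by simpa only [one_mul] using hS)
  simp only [Finset.sum_const, Finset.card_range, nsmul_eq_mul, mul_one] at this
  exact this

/-- The factorial moment `E T(T+1)` is the second moment of the Poissonized completion time. -/
lemma IsCouponSampling.integral_TReal_sq_add (h : IsCouponSampling μ M₁ M₂ p₁ p₂ C) :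
    Integrable (fun ω => TReal C ω ^ 2 + TReal C ω) μ ∧
      ∫ ω, (TReal C ω ^ 2 + TReal C ω) ∂μ =
        2 * ∫ t in Ioi (0 : ℝ), t * poissonTail (couponProb M₁ M₂ p₁ p₂) t := by
  have hS := h.hasSum_succ_mul_incomplete.mul_left 2
  simp_rw [← h.measureReal_lt_toNat_T] at hS
  have := integral_sum_range_of_hasSum (measurable_toNat_T h.measurable)
    (w := fun n => 2 * ((n : ℝ) + 1)) (fun n => by positivity)
    (by simpa only [mul_assoc] using hS)
  have hsum : ∀ k : ℕ, ∑ n ∈ Finset.range k, 2 * ((n : ℝ) + 1) = (k : ℝ) ^ 2 + k := by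
    intro k
    induction k with
    | zero => simp
    | succ k ih => rw [Finset.sum_range_succ, ih]; push_cast; ring
  simp only [hsum] at this
  exact this

lemma IsCouponSampling.memLp_TReal (h : IsCouponSampling μ M₁ M₂ p₁ p₂ C) :
    MemLp (TReal C) 2 μ := by
  have hm : AEStronglyMeasurable (TReal C) μ := h.integral_TReal.1.aestronglyMeasurable
  rw [memLp_two_iff_integrable_sq hm]
  refine (h.integral_TReal_sq_add.1.sub h.integral_TReal.1).congr ?_
  exact Eventually.of_forall fun ω => by simp

lemma IsCouponSampling.variance_TReal (h : IsCouponSampling μ M₁ M₂ p₁ p₂ C) :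
    variance (TReal C) μ =
      2 * (∫ t in Ioi (0 : ℝ), t * poissonTail (couponProb M₁ M₂ p₁ p₂) t) -
      (∫ t in Ioi (0 : ℝ), poissonTail (couponProb M₁ M₂ p₁ p₂) t) -
      (∫ t in Ioi (0 : ℝ), poissonTail (couponProb M₁ M₂ p₁ p₂) t) ^ 2 := by
  rw [variance_eq_sub h.memLp_TReal, ← h.integral_TReal_sq_add.2, ← h.integral_TReal.2,
    integral_add h.memLp_TReal.integrable_sq h.integral_TReal.1]
  simp

/-! ### Asymptotics of the variance -/

lemma poissonTail_couponProb (M₁ M₂ : ℕ) (p lam t : ℝ) :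
    poissonTail (couponProb M₁ M₂ p (lam * p)) t =
      expMaxTail M₁ (p * t) + tailExcess M₁ M₂ lam (p * t) := by
  simp only [poissonTail, couponProb, expMaxTail, tailExcess, Fintype.prod_sum_type, Sum.elim_inl,
    Sum.elim_inr, Finset.prod_const, Finset.card_univ, Fintype.card_fin]
  ring_nf

/-- The mean excess `E X - E Y` of the completion time `X` of both groups over that of the slower
group, `Y`, in units of `1 / p₁`. -/
noncomputable def meanExcess (N K : ℕ) (lam : ℝ) : ℝ := ∫ s in Ioi (0 : ℝ), tailExcess N K lam s

/-- Half the excess `E X² - E Y²` of second moments, in the notation of `meanExcess`. -/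
noncomputable def halfSqExcess (N K : ℕ) (lam : ℝ) : ℝ :=
  ∫ s in Ioi (0 : ℝ), s * tailExcess N K lam s

lemma integral_poissonTail_couponProb {M₁ : ℕ} (M₂ : ℕ) {p lam : ℝ} (hM : 0 < M₁) (hp : 0 < p)
    (hl : 1 < lam) :
    ∫ t in Ioi (0 : ℝ), poissonTail (couponProb M₁ M₂ p (lam * p)) t =
      p⁻¹ * (harm M₁ + meanExcess M₁ M₂ lam) := by
  simp_rw [poissonTail_couponProb]
  have h := integral_comp_mul_left_Ioi (fun s => expMaxTail M₁ s + tailExcess M₁ M₂ lam s) 0 hp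
  -- for integrability the exponent `1 < lam` suffices
  rw [mul_zero, smul_eq_mul, integral_add (integrableOn_expMaxTail M₁)
    (integrableOn_tailExcess M₁ M₂ hM one_pos hl), integral_expMaxTail] at h
  exact h

lemma two_mul_integral_mul_poissonTail_couponProb {M₁ : ℕ} (M₂ : ℕ) {p lam : ℝ} (hM : 0 < M₁)
    (hp : 0 < p) (hl : 1 < lam) :
    2 * ∫ t in Ioi (0 : ℝ), t * poissonTail (couponProb M₁ M₂ p (lam * p)) t =
      (p⁻¹) ^ 2 * (harm M₁ ^ 2 + ∑ i ∈ Finset.range M₁, 1 / ((i : ℝ) + 1) ^ 2 +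
        2 * halfSqExcess M₁ M₂ lam) := by
  have h := integral_comp_mul_left_Ioi
    (fun s => s * expMaxTail M₁ s + s * tailExcess M₁ M₂ lam s) 0 hp
  rw [mul_zero, smul_eq_mul, integral_add (integrableOn_mul_expMaxTail M₁)
    (integrableOn_mul_tailExcess M₁ M₂ hM one_pos hl)] at h
  have h2 : ∀ t, t * poissonTail (couponProb M₁ M₂ p (lam * p)) t =
      p⁻¹ * (p * t * expMaxTail M₁ (p * t) + p * t * tailExcess M₁ M₂ lam (p * t)) := by
    intro t
    rw [poissonTail_couponProb]
    field_simp
  simp_rw [h2]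
  rw [integral_const_mul, h, ← two_mul_integral_mul_expMaxTail, halfSqExcess]
  ring

lemma meanExcess_nonneg (N K : ℕ) {lam : ℝ} (hl : 0 < lam) : 0 ≤ meanExcess N K lam :=
  setIntegral_nonneg measurableSet_Ioi fun _ hs => tailExcess_nonneg N K hl hs

lemma halfSqExcess_nonneg (N K : ℕ) {lam : ℝ} (hl : 0 < lam) : 0 ≤ halfSqExcess N K lam :=
  setIntegral_nonneg measurableSet_Ioi fun _ hs =>
    mul_nonneg (le_of_lt hs) (tailExcess_nonneg N K hl hs)

section Limits

variable {ν₁ ν₂ : ℕ} {lam : ℝ}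

/-- Adding the faster group changes the first two moments by a negative power of `n`, in units of
`1 / p₁` and `1 / p₁²`. -/
lemma exists_excess_le (hν₁ : 1 ≤ ν₁) (hl : 1 < lam) :
    ∃ A b : ℝ, 0 ≤ A ∧ 0 < b ∧ ∀ n : ℕ, 0 < n →
      meanExcess (ν₁ * n) (ν₂ * n) lam ≤ A * (n : ℝ) ^ (-b) ∧
      halfSqExcess (ν₁ * n) (ν₂ * n) lam ≤ A * (n : ℝ) ^ (-b) := by
  -- any exponent strictly between `1` and `lam` works in `tailExcess_le`
  obtain ⟨a, ha1, hal⟩ := exists_between hl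
  have ha : 0 < a := one_pos.trans ha1
  have hla : 0 < lam - a := sub_pos.2 hal
  set B : ℝ := a ^ a * (ν₁ : ℝ) ^ (-a) * ν₂ with hB
  have hB0 : 0 ≤ B := by positivity
  have key : ∀ n : ℕ, 0 < n →
      a ^ a * ((ν₁ * n : ℕ) : ℝ) ^ (-a) * ((ν₂ * n : ℕ) : ℝ) = B * (n : ℝ) ^ (-(a - 1)) := by
    intro n hn
    have hn' : (0 : ℝ) < n := by exact_mod_cast hn
    rw [show -(a - 1) = -a + 1 by ring, rpow_add_one hn'.ne']
    push_cast
    rw [mul_rpow (by positivity) hn'.le]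
    ring
  have hx : 0 ≤ 1 / (lam - a) := by positivity
  have hy : 0 ≤ 1 / (lam - a) ^ 2 := by positivity
  refine ⟨B * (1 / (lam - a) + 1 / (lam - a) ^ 2), a - 1, by positivity, by linarith, ?_⟩
  intro n hn
  have hN : 0 < ν₁ * n := Nat.mul_pos hν₁ hn
  have h1 := integral_tailExcess_le (ν₁ * n) (ν₂ * n) hN ha hal
  have h2 := integral_mul_tailExcess_le (ν₁ * n) (ν₂ * n) hN ha hal
  rw [key n hn] at h1 h2
  have hr : 0 ≤ B * (n : ℝ) ^ (-(a - 1)) := by positivity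
  have hrx := mul_nonneg hr hx
  have hry := mul_nonneg hr hy
  constructor
  · rw [meanExcess]; linarith
  · rw [halfSqExcess]; linarith

lemma tendsto_natCast_rpow_neg {b : ℝ} (hb : 0 < b) :
    Tendsto (fun n : ℕ => (n : ℝ) ^ (-b)) atTop (𝓝 0) :=
  (tendsto_rpow_neg_atTop hb).comp tendsto_natCast_atTop_atTop

lemma tendsto_harm_mul_rpow_neg (hν₁ : 1 ≤ ν₁) {b : ℝ} (hb : 0 < b) :
    Tendsto (fun n : ℕ => harm (ν₁ * n) * (n : ℝ) ^ (-b)) atTop (𝓝 0) := by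
  have hlog : Tendsto (fun n : ℕ => log n * (n : ℝ) ^ (-b)) atTop (𝓝 0) := by
    refine ((isLittleO_log_rpow_atTop hb).tendsto_div_nhds_zero.comp
      tendsto_natCast_atTop_atTop).congr fun n => ?_
    simp [rpow_neg, div_eq_mul_inv]
  have h := ((tendsto_natCast_rpow_neg hb).const_mul (1 + log ν₁)).add hlog
  rw [mul_zero, add_zero] at h
  refine squeeze_zero' (Eventually.of_forall fun n => mul_nonneg (harm_nonneg _) (by positivity))
    ?_ h
  filter_upwards [eventually_gt_atTop 0] with n hn
  have h1 := harm_le_one_add_log (ν₁ * n)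
  push_cast at h1
  rw [log_mul (by positivity) (by positivity)] at h1
  have h2 := mul_le_mul_of_nonneg_right h1 (by positivity : 0 ≤ (n : ℝ) ^ (-b))
  linarith

lemma tendsto_sum_inv_sq (hν₁ : 1 ≤ ν₁) :
    Tendsto (fun n : ℕ => ∑ i ∈ Finset.range (ν₁ * n), 1 / ((i : ℝ) + 1) ^ 2) atTop
      (𝓝 (π ^ 2 / 6)) := by
  have h := (hasSum_nat_add_iff' 1).2 hasSum_zeta_two
  simp only [Finset.range_one, Finset.sum_singleton, Nat.cast_zero, Nat.cast_add, Nat.cast_one]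
    at h
  norm_num at h
  have h2 := h.tendsto_sum_nat.comp (tendsto_id.const_mul_atTop' (by omega : 0 < ν₁))
  simpa [Function.comp_def] using h2

/-- The normalized variance converges to that of the Gumbel distribution: the corrections are of
order `n^(-b) log n`, and the last one, which comes from the passage between `E T²` and
`E T(T+1)`, is of order `n⁻¹ log n`. -/
lemma tendsto_normalized_variance (hν₁ : 1 ≤ ν₁) (hl : 1 < lam) (c : ℝ) :
    Tendsto (fun n : ℕ => ∑ i ∈ Finset.range (ν₁ * n), 1 / ((i : ℝ) + 1) ^ 2 +
        2 * halfSqExcess (ν₁ * n) (ν₂ * n) lam -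
        2 * (harm (ν₁ * n) * meanExcess (ν₁ * n) (ν₂ * n) lam) -
        meanExcess (ν₁ * n) (ν₂ * n) lam ^ 2 -
        c * (harm (ν₁ * n) * (n : ℝ) ^ (-1 : ℝ) +
          meanExcess (ν₁ * n) (ν₂ * n) lam * (n : ℝ) ^ (-1 : ℝ))) atTop (𝓝 (π ^ 2 / 6)) := by
  obtain ⟨A, b, hA, hb, hAb⟩ := exists_excess_le (ν₂ := ν₂) hν₁ hl
  have hl0 : 0 < lam := one_pos.trans hl
  have hA0 : Tendsto (fun n : ℕ => A * (n : ℝ) ^ (-b)) atTop (𝓝 0) := by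
    simpa using (tendsto_natCast_rpow_neg hb).const_mul A
  have hmean : Tendsto (fun n : ℕ => meanExcess (ν₁ * n) (ν₂ * n) lam) atTop (𝓝 0) := by
    refine squeeze_zero' (Eventually.of_forall fun n => meanExcess_nonneg _ _ hl0) ?_ hA0
    filter_upwards [eventually_gt_atTop 0] with n hn using (hAb n hn).1
  have hsq : Tendsto (fun n : ℕ => halfSqExcess (ν₁ * n) (ν₂ * n) lam) atTop (𝓝 0) := by
    refine squeeze_zero' (Eventually.of_forall fun n => halfSqExcess_nonneg _ _ hl0) ?_ hA0
    filter_upwards [eventually_gt_atTop 0] with n hn using (hAb n hn).2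
  have hharm : Tendsto (fun n : ℕ => harm (ν₁ * n) * meanExcess (ν₁ * n) (ν₂ * n) lam) atTop
      (𝓝 0) := by
    have h := (tendsto_harm_mul_rpow_neg hν₁ hb).const_mul A
    rw [mul_zero] at h
    refine squeeze_zero' (Eventually.of_forall fun n =>
      mul_nonneg (harm_nonneg _) (meanExcess_nonneg _ _ hl0)) ?_ h
    filter_upwards [eventually_gt_atTop 0] with n hn
    have := mul_le_mul_of_nonneg_left (hAb n hn).1 (harm_nonneg (ν₁ * n))
    linarith
  have h := ((((tendsto_sum_inv_sq hν₁).add (hsq.const_mul 2)).sub (hharm.const_mul 2)).sub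
    (hmean.pow 2)).sub (((tendsto_harm_mul_rpow_neg hν₁ one_pos).add
      (hmean.mul (tendsto_natCast_rpow_neg one_pos))).const_mul c)
  simpa using h

end Limits

end CouponCollector

open CouponCollector in
theorem corollary4 (ν₁ ν₂ : ℕ) (hν₁ : 1 ≤ ν₁) (hν₂ : 1 ≤ ν₂) (lam : ℝ) (hlam : 1 < lam)
    (p₁ p₂ : ℕ+ → ℝ) (hratio : ∀ M : ℕ+, p₂ M / p₁ M = lam)
    {Ω : ℕ+ → Type*} [∀ M, MeasurableSpace (Ω M)] (μ : ∀ M, Measure (Ω M))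
    [∀ M, IsProbabilityMeasure (μ M)]
    (C : ∀ M : ℕ+, ℕ → Ω M → Fin (ν₁ * M) ⊕ Fin (ν₂ * M))
    (hC : ∀ M : ℕ+, CouponCollector.IsCouponSampling (μ M) (ν₁ * M) (ν₂ * M) (p₁ M) (p₂ M) (C M)) :
    (∀ M : ℕ+, (∀ᵐ ω ∂(μ M), CouponCollector.T (C M) ω ≠ ⊤) ∧
      MemLp (CouponCollector.TReal (C M)) 2 (μ M)) ∧
    (fun M : ℕ+ => variance (CouponCollector.TReal (C M)) (μ M)) ~[atTop]
      (fun M : ℕ+ => Real.pi ^ 2 * ((ν₁ : ℝ) + lam * (ν₂ : ℝ)) ^ 2 / 6 * ((M : ℕ) : ℝ) ^ 2) := by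
  refine ⟨fun M => ⟨(hC M).ae_T_ne_top, (hC M).memLp_TReal⟩, ?_⟩
  set c : ℝ := (ν₁ : ℝ) + lam * (ν₂ : ℝ) with hc
  have hc0 : 0 < c := by positivity
  have hlim := (tendsto_normalized_variance (ν₂ := ν₂) hν₁ hlam c⁻¹).comp
    tendsto_PNat_val_atTop_atTop
  rw [← isEquivalent_const_iff_tendsto (by positivity)] at hlim
  have heq := hlim.mul (IsEquivalent.refl (u := fun M : ℕ+ => c ^ 2 * ((M : ℕ) : ℝ) ^ 2))
  refine (heq.congr_left (Eventually.of_forall fun M => ?_)).congr_right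
    (Eventually.of_forall fun M => ?_)
  · have hM : (0 : ℝ) < ((M : ℕ) : ℝ) := by exact_mod_cast M.pos
    have hp := (hC M).pos₁
    have hp₂ : p₂ M = lam * p₁ M := by rw [← hratio M, div_mul_cancel₀ _ hp.ne']
    have hinv : (p₁ M)⁻¹ = c * (M : ℕ) := by
      refine inv_eq_of_mul_eq_one_left ?_
      have := (hC M).sum_eq_one
      push_cast at this
      rw [← this, hp₂, hc]
      ring
    have hN : 0 < ν₁ * (M : ℕ) := Nat.mul_pos hν₁ M.pos
    have hvar := (hC M).variance_TReal
    rw [hp₂, integral_poissonTail_couponProb _ hN hp hlam,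
      two_mul_integral_mul_poissonTail_couponProb _ hN hp hlam, hinv] at hvar
    rw [hvar]
    simp only [Function.comp_apply, Pi.mul_apply, Real.rpow_neg_one]
    field_simp
    ring
  · simp only [Pi.mul_apply, Function.const_apply]
    ring
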